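/- Let $\mathcal{H}$ be a separable complex Hilbert space with dual $\mathcal{H}^*$, and let $\mathcal{S}(\mathcal{K})$ denote the set of states (positive trace-class operators of trace $1$) on a Hilbert space $\mathcal{K}$. For a linear operator $B$ on $\mathcal{H}$ let $B^T$ be its transpose on $\mathcal{H}^*$, $(B^T\eta)(\varphi)=\eta(B\varphi)$. For $\rho,\omega\in\mathcal{S}(\mathcal{H})$ let $\mathcal{C}(\rho,\omega)$ be the set of couplings, i.e. of all $\Pi\in\mathcal{S}(\mathcal{H}\otimes\mathcal{H}^*)$ with partial traces $\mathrm{tr}_{\mathcal{H}^*}[\Pi]=\omega$ and $\mathrm{tr}_{\mathcal{H}}[\Pi]=\rho^T$. Let $\mathbf{FCO}(\mathcal{H})$ be the set of all finite sets $\mathcal{A}=\{A_1,\dots,A_K\}$ of self-adjoint, possibly unbounded, operators on $\mathcal{H}$, and let $E_k$ be the spectral measure of $A_k$. For $0<p<\infty$ define the positive, possibly unbounded, cost operator on $\mathcal{H}\otimes\mathcal{H}^*$ $$C_{\mathcal{A},p}=\sum_{k=1}^K\iint_{\mathbb{R}^2}|x-y|^p\,\mathrm{d}E_k(x)\otimes\mathrm{d}E_k^T(y)=\sum_{k=1}^K\bigl|A_k\otimes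 I^T-I\otimes A_k^T\bigr|^p,$$ where positive unbounded operators are identified with, and added and compared as, their quadratic forms $\psi\mapsto\langle\psi,C\psi\rangle\in[0,\infty]$. With $\mathrm{tr}[\Pi C]=\mathrm{tr}[\Pi^{1/2}C\,\Pi^{1/2}]\in[0,\infty]$, define the $p$-Wasserstein distance $$D_{\mathcal{A},p}(\rho,\omega)=\Bigl(\inf_{\Pi\in\mathcal{C}(\rho,\omega)}\mathrm{tr}\bigl[\Pi\,C_{\mathcal{A},p}\bigr]\Bigr)^{\min\{1/p,1\}}\in[0,\infty]$$ and the $p$-Wasserstein divergence $$d_{\mathcal{A},p}(\rho,\omega)=\Bigl(D_{\mathcal{A},p}^{\max\{p,1\}}(\rho,\omega)-\tfrac12\bigl(D_{\mathcal{A},p}^{\max\{p,1\}}(\rho,\rho)+D_{\mathcal{A},p}^{\max\{p,1\}}(\omega,\omega)\bigr)\Bigr)^{\min\{1/p,1\}}\in[0,\infty],$$ which is called well defined at $(\rho,\omega)$ if the subtracted term is finite and the difference is nonnegative. We say that the triangle inequality holds for $d_{\mathcal{A},p}$ if $$d_{\mathcal{A},p}(\rho,\omega)\le d_{\mathcal{A},p}(\rho,\tau)+d_{\mathcal{A},p}(\tau,\omega)$$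 for all $\rho,\tau,\omega\in\mathcal{S}(\mathcal{H})$ for which these three divergences are well defined. **Proposition.** Let $0<p\le p'<\infty$, and let $\mathcal{O},\mathcal{O}'\subseteq\mathbf{FCO}(\mathcal{H})$ be such that $$\{C_{\mathcal{A}',p'}\mid\mathcal{A}'\in\mathcal{O}'\}\subseteq\{C_{\mathcal{A},p}\mid\mathcal{A}\in\mathcal{O}\}.$$ If the triangle inequality holds for $d_{\mathcal{A},p}$ for every $\mathcal{A}\in\mathcal{O}$, then it holds for $d_{\mathcal{A}',p'}$ for every $\mathcal{A}'\in\mathcal{O}'$. Moreover, if for every $\mathcal{A}\in\mathcal{O}$ the divergence $d_{\mathcal{A},p}$ is well defined at all pairs $(\rho,\omega)$ of states with $D_{\mathcal{A},p}(\rho,\rho),D_{\mathcal{A},p}(\omega,\omega)<\infty$, then the same is true of $d_{\mathcal{A}',p'}$ for every $\mathcal{A}'\in\mathcal{O}'$. -/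

import Mathlib

open scoped ENNReal InnerProductSpace TensorProduct

noncomputable section

namespace QWass

universe u

/-! ### The dual Hilbert space, the transpose and the Hilbert space tensor product -/

section Dual

variable (H : Type u) [NormedAddCommGroup H] [InnerProductSpace ℂ H] [CompleteSpace H]

/-- The Hilbert space structure of the dual `H*` of a complex Hilbert space, transported along the
antilinear Riesz isomorphism: `⟪⟨x|, ⟨y|⟫ = ⟪y, x⟫`. The norm is the usual operator norm. -/
instance dualInnerProductSpace : InnerProductSpace ℂ (StrongDual ℂ H) where
  inner η ξ := ⟪(InnerProductSpace.toDual ℂ H).symm ξ, (InnerProductSpace.toDual ℂ H).symm η⟫_ℂ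
  norm_sq_eq_re_inner η := by
    rw [inner_self_eq_norm_sq_to_K, LinearIsometryEquiv.norm_map]
    norm_cast
  conj_inner_symm η ξ := inner_conj_symm _ _
  add_left η ξ ζ := by rw [map_add, inner_add_right]
  smul_left η ξ c := by
    rw [LinearIsometryEquiv.map_smulₛₗ, inner_smul_right]

/-- The Hilbert space `H ⊗ H*`: the completion of the algebraic tensor product. -/
abbrev Pair : Type u := UniformSpace.Completion (H ⊗[ℂ] StrongDual ℂ H)

variable {H}

/-- The transpose `Bᵀ : H* → H*`, `(Bᵀ η) φ = η (B φ)`, of a bounded operator. -/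
def transpose (B : H →L[ℂ] H) : StrongDual ℂ H →L[ℂ] StrongDual ℂ H :=
  (ContinuousLinearMap.compL ℂ H H ℂ).flip B

theorem transpose_apply (B : H →L[ℂ] H) (η : StrongDual ℂ H) (φ : H) :
    transpose B η φ = η (B φ) := rfl

end Dual

section Tensor

variable {E F : Type u} [NormedAddCommGroup E] [InnerProductSpace ℂ E]
  [NormedAddCommGroup F] [InnerProductSpace ℂ F]

theorem exists_orthonormal_tmul (x : E ⊗[ℂ] F) :
    ∃ (k : ℕ) (a : Fin k → E) (e : Fin k → F), Orthonormal ℂ e ∧ x = ∑ i, a i ⊗ₜ[ℂ] e i := by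
  obtain ⟨m, v, w, rfl⟩ := TensorProduct.exists_sum_tmul_eq x
  let F' : Submodule ℂ F := Submodule.span ℂ (Set.range w)
  have : FiniteDimensional ℂ F' := FiniteDimensional.span_of_finite ℂ (Set.finite_range w)
  let e := stdOrthonormalBasis ℂ F'
  have hw : ∀ j, w j = ∑ i, e.repr ⟨w j, Submodule.subset_span ⟨j, rfl⟩⟩ i • (e i : F) := by
    intro j
    have h := congrArg (fun z : F' => (z : F))
      (e.sum_repr ⟨w j, Submodule.subset_span ⟨j, rfl⟩⟩)
    simpa using h.symm
  refine ⟨_, fun i => ∑ j, e.repr ⟨w j, Submodule.subset_span ⟨j, rfl⟩⟩ i • v j,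
    fun i => (e i : F), e.orthonormal.comp_linearIsometry F'.subtypeₗᵢ, ?_⟩
  calc ∑ j, v j ⊗ₜ[ℂ] w j
      = ∑ j, v j ⊗ₜ[ℂ] (∑ i, e.repr ⟨w j, Submodule.subset_span ⟨j, rfl⟩⟩ i • (e i : F)) :=
        Finset.sum_congr rfl fun j _ => by rw [← hw j]
    _ = _ := by
        simp only [TensorProduct.tmul_sum, TensorProduct.sum_tmul, TensorProduct.tmul_smul,
          TensorProduct.smul_tmul']
        rw [Finset.sum_comm]

theorem norm_sq_sum_tmul {k : ℕ} (a : Fin k → E) {e : Fin k → F} (he : Orthonormal ℂ e) :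
    ‖∑ i, a i ⊗ₜ[ℂ] e i‖ ^ 2 = ∑ i, ‖a i‖ ^ 2 := by
  classical
  have h : ⟪∑ i, a i ⊗ₜ[ℂ] e i, ∑ i, a i ⊗ₜ[ℂ] e i⟫_ℂ = ∑ i, ((‖a i‖ ^ 2 : ℝ) : ℂ) := by
    simp [sum_inner, inner_sum, orthonormal_iff_ite.1 he, inner_self_eq_norm_sq_to_K]
  have h' := norm_sq_eq_re_inner (𝕜 := ℂ) (∑ i, a i ⊗ₜ[ℂ] e i)
  rw [h', h, ← Complex.ofReal_sum]
  exact Complex.ofReal_re _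

theorem norm_map_id_le (A : E →L[ℂ] E) (x : E ⊗[ℂ] F) :
    ‖TensorProduct.map A.toLinearMap LinearMap.id x‖ ≤ ‖A‖ * ‖x‖ := by
  obtain ⟨k, a, e, he, rfl⟩ := exists_orthonormal_tmul x
  refine le_of_sq_le_sq ?_ (by positivity)
  have h : TensorProduct.map A.toLinearMap LinearMap.id (∑ i, a i ⊗ₜ[ℂ] e i)
      = ∑ i, A (a i) ⊗ₜ[ℂ] e i := by simp
  rw [h, mul_pow, norm_sq_sum_tmul _ he, norm_sq_sum_tmul _ he, Finset.mul_sum]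
  refine Finset.sum_le_sum fun i _ => ?_
  rw [← mul_pow]
  gcongr
  exact A.le_opNorm _

theorem norm_id_map_le (B : F →L[ℂ] F) (x : E ⊗[ℂ] F) :
    ‖TensorProduct.map LinearMap.id B.toLinearMap x‖ ≤ ‖B‖ * ‖x‖ := by
  have h := norm_map_id_le B (TensorProduct.comm ℂ E F x)
  rw [TensorProduct.norm_comm] at h
  have h2 : TensorProduct.map B.toLinearMap LinearMap.id (TensorProduct.comm ℂ E F x)
      = TensorProduct.comm ℂ E F (TensorProduct.map LinearMap.id B.toLinearMap x) := by
    clear h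
    induction x using TensorProduct.induction_on with
    | zero => simp
    | tmul a b => simp
    | add a b ha hb => simp_all
  rwa [h2, TensorProduct.norm_comm] at h

/-- The bounded operator `A ⊗ B` on the Hilbert space tensor product. -/
def tensorOp (A : E →L[ℂ] E) (B : F →L[ℂ] F) :
    UniformSpace.Completion (E ⊗[ℂ] F) →L[ℂ] UniformSpace.Completion (E ⊗[ℂ] F) :=
  ((TensorProduct.map A.toLinearMap B.toLinearMap).mkContinuous (‖A‖ * ‖B‖) (fun x => by
    have h : TensorProduct.map A.toLinearMap B.toLinearMap x
        = TensorProduct.map A.toLinearMap LinearMap.id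
            (TensorProduct.map LinearMap.id B.toLinearMap x) := by
      rw [← LinearMap.comp_apply, ← TensorProduct.map_comp]
      simp
    rw [h, mul_assoc]
    exact (norm_map_id_le A _).trans
      (mul_le_mul_of_nonneg_left (norm_id_map_le B x) (norm_nonneg _)))).completion

theorem tensorOp_coe_tmul (A : E →L[ℂ] E) (B : F →L[ℂ] F) (φ : E) (η : F) :
    tensorOp A B ((φ ⊗ₜ[ℂ] η : E ⊗[ℂ] F) : UniformSpace.Completion (E ⊗[ℂ] F))
      = ((A φ ⊗ₜ[ℂ] B η : E ⊗[ℂ] F) : UniformSpace.Completion (E ⊗[ℂ] F)) := by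
  simp [tensorOp]

end Tensor

/-! ### States, traces and couplings -/

section States

/-- The vectors of a fixed orthonormal basis of a Hilbert space. -/
def stdIndex (K : Type u) [NormedAddCommGroup K] [InnerProductSpace ℂ K] [CompleteSpace K] :
    Set K :=
  (exists_hilbertBasis ℂ K).choose

/-- A fixed orthonormal basis, indexed by `stdIndex K`. -/
def stdBasis (K : Type u) [NormedAddCommGroup K] [InnerProductSpace ℂ K] [CompleteSpace K] :
    HilbertBasis (stdIndex K) ℂ K :=
  (exists_hilbertBasis ℂ K).choose_spec.choose

variable {K : Type u} [NormedAddCommGroup K] [InnerProductSpace ℂ K] [CompleteSpace K]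

/-- The trace `∑ᵢ ⟨eᵢ, T eᵢ⟩` of a trace-class operator (the value does not depend on the
orthonormal basis). It is only applied to trace-class operators. -/
def opTrace (T : K →L[ℂ] K) : ℂ :=
  ∑' i, ⟪stdBasis K i, T (stdBasis K i)⟫_ℂ

variable (K) in
/-- A state: a positive trace-class operator of unit trace. For a positive operator, being trace
class means that the nonnegative series `∑ᵢ ⟨eᵢ, T eᵢ⟩` converges for one (equivalently every)
orthonormal basis; its sum is then the trace. -/
structure State where
  op : K →L[ℂ] K
  isPositive : op.IsPositive
  hasTrace_one : HasSum (fun i => ⟪stdBasis K i, op (stdBasis K i)⟫_ℂ) 1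

variable {H : Type u} [NormedAddCommGroup H] [InnerProductSpace ℂ H] [CompleteSpace H]

/-- The couplings of `ρ` and `ω`: the states `P` on `H ⊗ H*` whose partial traces are
`tr_{H*} P = ω` and `tr_H P = ρᵀ`, that is, `tr[(A ⊗ I) P] = tr[ω A]` and
`tr[(I ⊗ Bᵀ) P] = tr[ρ B]` for all bounded self-adjoint `A`, `B`. -/
def couplings (ρ ω : State H) : Set (State (Pair H)) :=
  {P | (∀ A : H →L[ℂ] H, IsSelfAdjoint A →
          opTrace (tensorOp A (ContinuousLinearMap.id ℂ (StrongDual ℂ H)) ∘L P.op)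
            = opTrace (ω.op ∘L A)) ∧
       (∀ B : H →L[ℂ] H, IsSelfAdjoint B →
          opTrace (tensorOp (ContinuousLinearMap.id ℂ H) (transpose B) ∘L P.op)
            = opTrace (ρ.op ∘L B))}

end States

/-! ### Spectral measures -/

/-- A projection-valued measure on `X` with values in the orthogonal projections of `K`
(normalised to be `0` on non-measurable sets). -/
structure SpectralMeasure (X : Type*) [MeasurableSpace X] (K : Type*) [NormedAddCommGroup K]
    [InnerProductSpace ℂ K] [CompleteSpace K] where
  proj : Set X → K →L[ℂ] K
  isStarProjection : ∀ S, MeasurableSet S → IsStarProjection (proj S)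
  proj_empty : proj ∅ = 0
  proj_univ : proj Set.univ = 1
  proj_not_measurable : ∀ S, ¬ MeasurableSet S → proj S = 0
  hasSum_proj : ∀ f : ℕ → Set X, (∀ n, MeasurableSet (f n)) →
    Pairwise (fun m n => Disjoint (f m) (f n)) →
    ∀ ψ : K, HasSum (fun n => proj (f n) ψ) (proj (⋃ n, f n) ψ)

namespace SpectralMeasure

variable {X : Type*} [MeasurableSpace X] {K : Type*} [NormedAddCommGroup K]
  [InnerProductSpace ℂ K] [CompleteSpace K]

/-- The finite measure `S ↦ ⟨ψ, E(S) ψ⟩`. -/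
def measure (E : SpectralMeasure X K) (ψ : K) : MeasureTheory.Measure X :=
  MeasureTheory.Measure.ofMeasurable
    (fun S _ => ENNReal.ofReal (RCLike.re ⟪ψ, E.proj S ψ⟫_ℂ))
    (by simp [E.proj_empty])
    (by
      intro f hf hd
      have h := (innerSL ℂ ψ).hasSum (E.hasSum_proj f hf hd ψ)
      have h2 := RCLike.reCLM.hasSum h
      have hnn : ∀ n, 0 ≤ RCLike.re ⟪ψ, E.proj (f n) ψ⟫_ℂ := fun n =>
        (ContinuousLinearMap.IsPositive.of_isStarProjection
          (E.isStarProjection _ (hf n))).re_inner_nonneg_right ψ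
      have h3 := ENNReal.ofReal_tsum_of_nonneg hnn h2.summable
      rw [← h3]
      exact congrArg ENNReal.ofReal h2.tsum_eq.symm)

/-- The trivial example: the unit mass at a point. -/
def dirac (x : X) : SpectralMeasure X K := by
  classical
  exact
  { proj := fun S => if MeasurableSet S ∧ x ∈ S then 1 else 0
    isStarProjection := fun S _ => by split_ifs <;> simp
    proj_empty := by simp
    proj_univ := by simp
    proj_not_measurable := fun S hS => by simp [hS]
    hasSum_proj := by
      intro f hf hd ψ
      by_cases hx : x ∈ ⋃ n, f n
      · obtain ⟨n, hn⟩ := Set.mem_iUnion.1 hx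
        have hm : MeasurableSet (⋃ n, f n) := MeasurableSet.iUnion hf
        rw [if_pos ⟨hm, hx⟩]
        convert hasSum_single n ?_ using 1
        · rw [if_pos ⟨hf n, hn⟩]
        · intro m hmn
          have : x ∉ f m := fun h => Set.disjoint_left.1 (hd hmn) h hn
          simp [this]
      · have : ∀ n, x ∉ f n := fun n h => hx (Set.mem_iUnion.2 ⟨n, h⟩)
        simp [hx, this] }

instance [Inhabited X] : Nonempty (SpectralMeasure X K) := ⟨dirac default⟩

end SpectralMeasure

/-! ### Observables and their spectral resolutions -/

section Observables

variable (H : Type u) [NormedAddCommGroup H] [InnerProductSpace ℂ H] [CompleteSpace H]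

/-- An observable: a self-adjoint, possibly unbounded, (densely defined) operator on `H`. -/
def Observable : Type u := {A : H →ₗ.[ℂ] H // IsSelfAdjoint A}

variable {H}

/-- `A = ∫ x dE(x)`: the domain of `A` is `{ψ | ∫ x² d⟨ψ, E(x) ψ⟩ < ∞}`, and
`⟨ψ, A ψ⟩ = ∫ x d⟨ψ, E(x) ψ⟩` on it. -/
def IsSpectralResolution (A : H →ₗ.[ℂ] H) (E : SpectralMeasure ℝ H) : Prop :=
  (∀ ψ : H, ψ ∈ A.domain ↔ ∫⁻ x, ENNReal.ofReal (x ^ 2) ∂(E.measure ψ) < ∞) ∧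
  (∀ ψ : A.domain, ⟪(ψ : H), A ψ⟫_ℂ = ((∫ x, x ∂(E.measure (ψ : H)) : ℝ) : ℂ))

/-- The spectral resolution of an observable: the projection-valued measure `E` on `ℝ` with
`A = ∫ x dE(x)`, which exists and is unique by the spectral theorem. -/
def spectralResolution (A : Observable H) : SpectralMeasure ℝ H :=
  Classical.epsilon fun E => IsSpectralResolution A.1 E

/-- `G = E ⊗ Eᵀ`: `G(S × T) = E(S) ⊗ E(T)ᵀ` for all Borel sets `S`, `T`. -/
def IsProductWithTranspose (E : SpectralMeasure ℝ H) (G : SpectralMeasure (ℝ × ℝ) (Pair H)) :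
    Prop :=
  ∀ S T : Set ℝ, MeasurableSet S → MeasurableSet T →
    G.proj (S ×ˢ T) = tensorOp (E.proj S) (transpose (E.proj T))

/-- The product spectral measure `dE(x) ⊗ dEᵀ(y)` on `ℝ²` with values in the projections of
`H ⊗ H*`: the unique projection-valued measure with the prescribed values on rectangles. -/
def prodTranspose (E : SpectralMeasure ℝ H) : SpectralMeasure (ℝ × ℝ) (Pair H) :=
  Classical.epsilon fun G => IsProductWithTranspose E G

end Observables

/-! ### Cost operators, Wasserstein distances and divergences -/

section Wasserstein

variable {H : Type u} [NormedAddCommGroup H] [InnerProductSpace ℂ H] [CompleteSpace H]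

/-- The positive, possibly unbounded, cost operator
`C_{𝒜,p} = ∑ₖ ∬ |x - y|ᵖ dEₖ(x) ⊗ dEₖᵀ(y) = ∑ₖ |Aₖ ⊗ Iᵀ - I ⊗ Aₖᵀ|ᵖ` on `H ⊗ H*`.
A positive unbounded operator is represented by its quadratic form `ψ ↦ ⟨ψ, C ψ⟩ ∈ [0, ∞]` (equal
to `∞` off the form domain), which determines it; sums of positive operators are form sums. -/
def costOperator (𝒜 : Finset (Observable H)) (p : ℝ) : Pair H → ℝ≥0∞ := fun ψ =>
  ∑ A ∈ 𝒜, ∫⁻ z : ℝ × ℝ, ENNReal.ofReal (|z.1 - z.2| ^ p)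
    ∂((prodTranspose (spectralResolution A)).measure ψ)

/-- `tr[P C] = tr[P^{1/2} C P^{1/2}] = ∑ᵢ ⟨P^{1/2} eᵢ, C P^{1/2} eᵢ⟩ ∈ [0, ∞]` for a state `P` and
a positive operator `C` given by its quadratic form. -/
def costTrace {K : Type u} [NormedAddCommGroup K] [InnerProductSpace ℂ K] [CompleteSpace K]
    (P : State K) (C : K → ℝ≥0∞) : ℝ≥0∞ :=
  ∑' i, C (CFC.sqrt P.op (stdBasis K i))

/-- The `p`-Wasserstein distance
`D_{𝒜,p}(ρ, ω) = (inf {tr[P C_{𝒜,p}] | P coupling of ρ and ω})^{min(1/p, 1)} ∈ [0, ∞]`. -/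
def wassersteinDistance (𝒜 : Finset (Observable H)) (p : ℝ) (ρ ω : State H) : ℝ≥0∞ :=
  (⨅ P ∈ couplings ρ ω, costTrace P (costOperator 𝒜 p)) ^ min (1 / p) 1

/-- `(D_{𝒜,p}(ρ, ρ)^{max(p, 1)} + D_{𝒜,p}(ω, ω)^{max(p, 1)}) / 2`. -/
def selfTerm (𝒜 : Finset (Observable H)) (p : ℝ) (ρ ω : State H) : ℝ≥0∞ :=
  (wassersteinDistance 𝒜 p ρ ρ ^ max p 1 + wassersteinDistance 𝒜 p ω ω ^ max p 1) / 2

/-- The difference `D_{𝒜,p}(ρ, ω)^{max(p, 1)} - (D_{𝒜,p}(ρ, ρ)^{max(p, 1)} +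
D_{𝒜,p}(ω, ω)^{max(p, 1)}) / 2` is meaningful (the subtracted term is finite) and nonnegative, so
that the divergence `d_{𝒜,p}(ρ, ω)` is well defined. -/
def DivergenceDefined (𝒜 : Finset (Observable H)) (p : ℝ) (ρ ω : State H) : Prop :=
  selfTerm 𝒜 p ρ ω ≠ ∞ ∧ selfTerm 𝒜 p ρ ω ≤ wassersteinDistance 𝒜 p ρ ω ^ max p 1

/-- The `p`-Wasserstein divergence
`d_{𝒜,p}(ρ, ω) = (D_{𝒜,p}(ρ, ω)^{max(p, 1)} - (D_{𝒜,p}(ρ, ρ)^{max(p, 1)} +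
D_{𝒜,p}(ω, ω)^{max(p, 1)}) / 2)^{min(1/p, 1)} ∈ [0, ∞]`.
The subtraction in `[0, ∞]` is the true one only if `DivergenceDefined 𝒜 p ρ ω`; the divergence
is only used under that condition. -/
def wassersteinDivergence (𝒜 : Finset (Observable H)) (p : ℝ) (ρ ω : State H) : ℝ≥0∞ :=
  (wassersteinDistance 𝒜 p ρ ω ^ max p 1 - selfTerm 𝒜 p ρ ω) ^ min (1 / p) 1

/-- The triangle inequality for `d_{𝒜,p}`, for all states for which the divergences involved are
well defined. -/
def TriangleInequality (𝒜 : Finset (Observable H)) (p : ℝ) : Prop :=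
  ∀ ρ τ ω : State H, DivergenceDefined 𝒜 p ρ ω → DivergenceDefined 𝒜 p ρ τ →
    DivergenceDefined 𝒜 p τ ω →
    wassersteinDivergence 𝒜 p ρ ω ≤ wassersteinDivergence 𝒜 p ρ τ + wassersteinDivergence 𝒜 p τ ω

/-- `d_{𝒜,p}(ρ, ω)` is well defined for all states `ρ`, `ω` of finite distance from themselves (for
bounded observables: for all states). -/
def DivergenceWellDefined (𝒜 : Finset (Observable H)) (p : ℝ) : Prop :=
  ∀ ρ ω : State H, wassersteinDistance 𝒜 p ρ ρ ≠ ∞ → wassersteinDistance 𝒜 p ω ω ≠ ∞ →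
    DivergenceDefined 𝒜 p ρ ω

end Wasserstein

end QWass

end

namespace QWass

universe v

section OptimalCost

variable {H : Type v} [NormedAddCommGroup H] [InnerProductSpace ℂ H] [CompleteSpace H]

/-! The exponents `min (1 / p) 1` and `max p 1` are reciprocal, so `D ^ max p 1` is the bare optimal
cost, which sees the observables and `p` only through the cost operator
(`wassersteinDistance_rpow_max`). If two cost operators agree, then so do the self terms and the
differences defining the divergences; only the outer exponent still depends on `p`. Hence `d' = d ^
θ` with `θ = min (1 / p') 1 / min (1 / p) 1` (`wassersteinDivergence_eq_rpow`).

For `p ≤ p'` one has `0 < θ ≤ 1`, so `t ↦ t ^ θ` is monotone and subadditive on `[0, ∞]`, and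
raising to the power `θ` preserves the triangle inequality (the snowflake argument). No property of
couplings, traces or spectral measures enters. -/

/-- The optimal transport cost `inf {tr[P C] | P coupling of ρ and ω}`. -/
noncomputable def optimalCost (C : Pair H → ℝ≥0∞) (ρ ω : State H) : ℝ≥0∞ :=
  ⨅ P ∈ couplings ρ ω, costTrace P C

theorem min_inv_one_mul_max_one {p : ℝ} (hp : 0 < p) : min (1 / p) 1 * max p 1 = 1 := by
  rcases le_total p 1 with h | h
  · rw [min_eq_right ((one_le_div hp).2 h), max_eq_right h, one_mul]
  · rw [min_eq_left ((div_le_one hp).2 h), max_eq_left h, one_div_mul_cancel hp.ne']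

theorem min_inv_one_pos {p : ℝ} (hp : 0 < p) : 0 < min (1 / p) 1 :=
  lt_min (by positivity) one_pos

/-- The two exponents multiply to `1`. The power law holds on all of `[0, ∞]` here, so infinite
costs need no separate treatment. -/
theorem wassersteinDistance_rpow_max {p : ℝ} (hp : 0 < p) (𝒜 : Finset (Observable H))
    (ρ ω : State H) :
    wassersteinDistance 𝒜 p ρ ω ^ max p 1 = optimalCost (costOperator 𝒜 p) ρ ω := by
  rw [wassersteinDistance, ← ENNReal.rpow_mul, min_inv_one_mul_max_one hp, ENNReal.rpow_one,
    optimalCost]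

/-- A positive power is infinite only at `∞`. -/
theorem wassersteinDistance_ne_top_iff {p : ℝ} (hp : 0 < p) (𝒜 : Finset (Observable H))
    (ρ ω : State H) :
    wassersteinDistance 𝒜 p ρ ω ≠ ∞ ↔ optimalCost (costOperator 𝒜 p) ρ ω ≠ ∞ := by
  rw [wassersteinDistance, Ne, ENNReal.rpow_eq_top_iff_of_pos (min_inv_one_pos hp), optimalCost]

theorem selfTerm_eq {p : ℝ} (hp : 0 < p) (𝒜 : Finset (Observable H)) (ρ ω : State H) :
    selfTerm 𝒜 p ρ ω = (optimalCost (costOperator 𝒜 p) ρ ρ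
      + optimalCost (costOperator 𝒜 p) ω ω) / 2 := by
  rw [selfTerm, wassersteinDistance_rpow_max hp, wassersteinDistance_rpow_max hp]

variable {p p' : ℝ} {𝒜 𝒜' : Finset (Observable H)}

theorem selfTerm_congr (hp : 0 < p) (hp' : 0 < p')
    (hC : costOperator 𝒜' p' = costOperator 𝒜 p) (ρ ω : State H) :
    selfTerm 𝒜' p' ρ ω = selfTerm 𝒜 p ρ ω := by
  rw [selfTerm_eq hp', selfTerm_eq hp, hC]

theorem divergenceDefined_congr (hp : 0 < p) (hp' : 0 < p')
    (hC : costOperator 𝒜' p' = costOperator 𝒜 p) (ρ ω : State H) :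
    DivergenceDefined 𝒜' p' ρ ω ↔ DivergenceDefined 𝒜 p ρ ω := by
  rw [DivergenceDefined, DivergenceDefined, selfTerm_congr hp hp' hC,
    wassersteinDistance_rpow_max hp', wassersteinDistance_rpow_max hp, hC]

/-- Both divergences are powers of the same base, so their exponents differ by the factor `θ`.
Equality of the bases makes this valid even where the truncated subtraction is not the true one. -/
theorem wassersteinDivergence_eq_rpow (hp : 0 < p) (hp' : 0 < p')
    (hC : costOperator 𝒜' p' = costOperator 𝒜 p) (ρ ω : State H) :
    wassersteinDivergence 𝒜' p' ρ ω
      = wassersteinDivergence 𝒜 p ρ ω ^ (min (1 / p') 1 / min (1 / p) 1) := by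
  rw [wassersteinDivergence, wassersteinDivergence, ← ENNReal.rpow_mul,
    mul_div_cancel₀ _ (min_inv_one_pos hp).ne', selfTerm_congr hp hp' hC,
    wassersteinDistance_rpow_max hp', wassersteinDistance_rpow_max hp, hC]

theorem TriangleInequality.of_costOperator_eq (hp : 0 < p) (hpp' : p ≤ p')
    (hC : costOperator 𝒜' p' = costOperator 𝒜 p) (h : TriangleInequality 𝒜 p) :
    TriangleInequality 𝒜' p' := by
  have hp' : 0 < p' := hp.trans_le hpp'
  intro ρ τ ω h₁ h₂ h₃
  rw [divergenceDefined_congr hp hp' hC] at h₁ h₂ h₃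
  simp only [wassersteinDivergence_eq_rpow hp hp' hC]
  have h_nonneg : 0 ≤ min (1 / p') 1 / min (1 / p) 1 :=
    div_nonneg (min_inv_one_pos hp').le (min_inv_one_pos hp).le
  -- The ordering of the exponents matters only here: `q ↦ min (1 / q) 1` is antitone.
  have h_le : min (1 / p') 1 / min (1 / p) 1 ≤ 1 :=
    (div_le_one (min_inv_one_pos hp)).2
      (min_le_min_right 1 (one_div_le_one_div_of_le hp hpp'))
  -- Monotonicity of `t ↦ t ^ θ`, then `(a + b) ^ θ ≤ a ^ θ + b ^ θ`.
  exact (ENNReal.rpow_le_rpow (h ρ τ ω h₁ h₂ h₃) h_nonneg).trans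
    (ENNReal.rpow_add_le_add_rpow _ _ h_nonneg h_le)

/-- Finiteness and nonnegativity are statements about optimal costs alone, so positivity of both
exponents suffices and they need not be ordered. -/
theorem DivergenceWellDefined.of_costOperator_eq (hp : 0 < p) (hp' : 0 < p')
    (hC : costOperator 𝒜' p' = costOperator 𝒜 p) (h : DivergenceWellDefined 𝒜 p) :
    DivergenceWellDefined 𝒜' p' := by
  intro ρ ω hρ hω
  rw [wassersteinDistance_ne_top_iff hp', hC, ← wassersteinDistance_ne_top_iff hp] at hρ hω
  exact (divergenceDefined_congr hp hp' hC ρ ω).2 (h ρ ω hρ hω)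

end OptimalCost

end QWass

theorem mainTheorem4 {H : Type*} [NormedAddCommGroup H] [InnerProductSpace ℂ H] [CompleteSpace H]
    [TopologicalSpace.SeparableSpace H]
    (p p' : ℝ) (hp : 0 < p) (hpp' : p ≤ p')
    (O O' : Set (Finset (QWass.Observable H)))
    (hO : {C | ∃ 𝒜' ∈ O', C = QWass.costOperator 𝒜' p'} ⊆
      {C | ∃ 𝒜 ∈ O, C = QWass.costOperator 𝒜 p}) :
    ((∀ 𝒜 ∈ O, QWass.TriangleInequality 𝒜 p) → ∀ 𝒜' ∈ O', QWass.TriangleInequality 𝒜' p') ∧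
    ((∀ 𝒜 ∈ O, QWass.DivergenceWellDefined 𝒜 p) →
      ∀ 𝒜' ∈ O', QWass.DivergenceWellDefined 𝒜' p') := by
  refine ⟨fun h 𝒜' h𝒜' => ?_, fun h 𝒜' h𝒜' => ?_⟩
  -- The inclusion supplies, for each `𝒜'`, some `𝒜 ∈ O` with the same cost operator.
  · obtain ⟨𝒜, h𝒜, hC⟩ := hO ⟨𝒜', h𝒜', rfl⟩
    exact (h 𝒜 h𝒜).of_costOperator_eq hp hpp' hC
  · obtain ⟨𝒜, h𝒜, hC⟩ := hO ⟨𝒜', h𝒜', rfl⟩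
    exact (h 𝒜 h𝒜).of_costOperator_eq hp (hp.trans_le hpp') hC
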